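/- All continua are nonempty, compact, connected and metrizable; a Peano continuum is a locally connected continuum; an arc is a space homeomorphic to $[0,1]$; a dendrite is a Peano continuum that contains no simple closed curve (no subspace homeomorphic to the circle). For a continuum $X$ let $\operatorname{Cont}(X)$ be the set of all (nonempty) subcontinua of $X$ with the Vietoris topology. $X$ is called generically hereditarily equivalent (GHEC) if $\{K\in\operatorname{Cont}(X) : K \text{ is homeomorphic to } X\}$ is comeager in $\operatorname{Cont}(X)$. The order $\operatorname{ord}(x,X)$ of a point $x\in X$ is the least cardinal $\kappa$ such that every open neighborhood $U$ of $x$ contains an open neighborhood $V$ of $x$ whose boundary $\partial V$ has at most $\kappa$ points; a branching point is a point of order greater than $2$. **Corollary.** Let $X$ be a Peano continuum with more than one point that is GHEC. Then either $X$ is an arc, or $X$ is a dendrite such that for every $m\in\mathbb{N}\cup\{\omega\}$ the set of branching points of $X$ of order $m$ is either dense in $X$ or empty. -/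

import Mathlib

open TopologicalSpace

namespace PeanoGHEC

/-- A continuum: a nonempty, compact, connected, metrizable space
(`ConnectedSpace` includes nonemptiness). -/
structure IsContinuum (X : Type*) [TopologicalSpace X] : Prop where
  compact : CompactSpace X
  connected : ConnectedSpace X
  metrizable : MetrizableSpace X

/-- A Peano continuum: a locally connected continuum. -/
structure IsPeanoContinuum (X : Type*) [TopologicalSpace X] : Prop extends IsContinuum X where
  locallyConnected : LocallyConnectedSpace X

/-- An arc: a homeomorphic image of `[0,1]`. -/
def IsArc (X : Type*) [TopologicalSpace X] : Prop :=
  Nonempty (unitInterval ≃ₜ X)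

/-- A dendrite: a Peano continuum containing no simple closed curve, that is, no subspace
homeomorphic to the circle. -/
structure IsDendrite (X : Type*) [TopologicalSpace X] : Prop extends IsPeanoContinuum X where
  no_simple_closed_curve : ∀ S : Set X, ¬ Nonempty (Circle ≃ₜ S)

/-- The hyperspace of (nonempty) subcontinua of `X`. It carries the subspace topology of the
Vietoris topology on the nonempty compact subsets of `X`. -/
abbrev Cont (X : Type*) [TopologicalSpace X] : Type _ :=
  {K : NonemptyCompacts X // IsConnected (K : Set X)}

/-- `X` is generically hereditarily equivalent: the subcontinua of `X` homeomorphic to `X` form a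
comeager subset of the hyperspace of subcontinua. -/
def IsGHEC (X : Type*) [TopologicalSpace X] : Prop :=
  {K : Cont X | Nonempty ((K.1 : Set X) ≃ₜ X)} ∈ residual (Cont X)

/-- The (Menger--Urysohn) order of a point `x`: the least cardinal `κ` such that `x` has
arbitrarily small open neighbourhoods whose boundary has at most `κ` points. -/
noncomputable def order {X : Type*} [TopologicalSpace X] (x : X) : Cardinal :=
  sInf {κ | ∀ U : Set X, IsOpen U → x ∈ U →
    ∃ V : Set X, IsOpen V ∧ x ∈ V ∧ V ⊆ U ∧ Cardinal.mk (frontier V) ≤ κ}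

/-- The branching points (points of order greater than two) whose order is `m`. -/
def branchingPointsOfOrder (X : Type*) [TopologicalSpace X] (m : Cardinal) : Set X :=
  {x | 2 < order x ∧ order x = m}

end PeanoGHEC

namespace PeanoGHEC

open Set Topology

universe u

/-! ### Compact connected sets inside connected open sets -/

section Continua

variable {X : Type*} [TopologicalSpace X]

/-! The hyperspace `Cont X` is compact metrizable, hence Baire. So any countable family of generic
properties is shared by some subcontinuum that is also a copy of `X`, and such a copy may even be
found inside any given nonempty open set. Two generic properties suffice.

The first is tree-likeness. For each δ the subcontinua covered by a forest of open sets of diameter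
at most δ form an open dense set: to approximate `K`, join a finite net of `K` inside a thin
connected neighbourhood by adding shortest chains of small sets one after another
(`exists_isForest_of_finite`). Hence `X` itself has such covers for every δ. The intersection graph
of a forest is acyclic, so all connected sets joining `x` to `y` pass close to a common point; a
limit as δ → 0 gives a third point separating `x` from `y` (`cutPointSeparated_of_isForest`). This
rules out circles.

The second concerns branching. With point separation, the order of `p` is the number of components
of `X \ {p}` (`CutPointSeparated.order_eq`). Only countably many points have three or more
components, each with countably many, and a generic `K` through such a point meets all of them. For
a locally connected `K` with this property, branching points have the same order in `K` as in `X`. A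
generic copy of `X` inside an open set `U` therefore carries a branching point of order `m` into
`U`. -/

theorem exists_isCompact_isPreconnected_subset [T2Space X] [CompactSpace X]
    [LocallyConnectedSpace X] {y : X} {U : Set X} (hU : U ∈ 𝓝 y) :
    ∃ M ⊆ U, IsCompact M ∧ IsPreconnected M ∧ M ∈ 𝓝 y := by
  obtain ⟨C, hC, hCc, hCU⟩ := exists_mem_nhds_isClosed_subset hU
  obtain ⟨V, hVC, hVo, hyV, hV⟩ :=
    locallyConnectedSpace_iff_subsets_isOpen_isConnected.1 ‹_› y C hC
  exact ⟨closure V, (closure_minimal hVC hCc).trans hCU, isClosed_closure.isCompact,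
    hV.isPreconnected.closure, Filter.mem_of_superset (hVo.mem_nhds hyV) subset_closure⟩

/-- Any two points of a connected open set `E` of a locally connected compact space lie in a
common compact connected subset of `E`, which is a neighbourhood of the second one. -/
theorem exists_isCompact_isPreconnected_mem_nhds [T2Space X] [CompactSpace X]
    [LocallyConnectedSpace X] {E : Set X} (hE : IsOpen E) (hc : IsPreconnected E) {x y : X}
    (hx : x ∈ E) (hy : y ∈ E) :
    ∃ M ⊆ E, IsCompact M ∧ IsPreconnected M ∧ x ∈ M ∧ M ∈ 𝓝 y := by
  set S : Set X := {y | ∃ M ⊆ E, IsCompact M ∧ IsPreconnected M ∧ x ∈ M ∧ M ∈ 𝓝 y}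
  have hS : IsOpen S := by
    refine isOpen_iff_mem_nhds.2 fun z ⟨M, h1, h2, h3, h4, h5⟩ => ?_
    filter_upwards [eventually_mem_nhds_iff.2 h5] with w hw
    exact ⟨M, h1, h2, h3, h4, hw⟩
  refine hc.subset_of_closure_inter_subset hS ⟨x, hx, ?_⟩ ?_ hy
  · obtain ⟨M, h1, h2, h3, h4⟩ := exists_isCompact_isPreconnected_subset (hE.mem_nhds hx)
    exact ⟨M, h1, h2, h3, mem_of_mem_nhds h4, h4⟩
  · rintro z ⟨hz, hzE⟩
    obtain ⟨N, h1, h2, h3, h4⟩ := exists_isCompact_isPreconnected_subset (hE.mem_nhds hzE)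
    obtain ⟨w, hwN, M, m1, m2, m3, m4, m5⟩ := mem_closure_iff_nhds.1 hz N h4
    exact ⟨M ∪ N, union_subset m1 h1, m2.union h2, m3.union w (mem_of_mem_nhds m5) hwN h3,
      Or.inl m4, Filter.mem_of_superset h4 subset_union_right⟩

/-- Finitely many compact connected sets through one base point cover `F`, and their union is
connected. This is used repeatedly to gain positive distance from a point or closed set that a
connected open set avoids. -/
theorem exists_isCompact_isPreconnected_superset [T2Space X] [CompactSpace X]
    [LocallyConnectedSpace X] {E F : Set X} (hE : IsOpen E) (hc : IsPreconnected E)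
    (hF : IsCompact F) (hFE : F ⊆ E) : ∃ M ⊆ E, IsCompact M ∧ IsPreconnected M ∧ F ⊆ M := by
  rcases F.eq_empty_or_nonempty with rfl | ⟨x, hx⟩
  · exact ⟨∅, empty_subset _, isCompact_empty, isPreconnected_empty, Subset.rfl⟩
  choose! M h1 h2 h3 h4 h5 using fun y (hy : y ∈ E) =>
    exists_isCompact_isPreconnected_mem_nhds hE hc (hFE hx) hy
  obtain ⟨t, htF, ht⟩ := hF.elim_nhds_subcover M fun y hy => h5 y (hFE hy)
  refine ⟨⋃ y ∈ t, M y, iUnion₂_subset fun y hy => h1 y (hFE (htF y hy)),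
    t.isCompact_biUnion fun y hy => h2 y (hFE (htF y hy)), ?_, ht⟩
  refine isPreconnected_of_forall x fun y hy => ?_
  obtain ⟨z, hz, hy⟩ := mem_iUnion₂.1 hy
  exact ⟨M z, subset_iUnion₂_of_subset z hz Subset.rfl, h4 z (hFE (htF z hz)), hy,
    h3 z (hFE (htF z hz))⟩

end Continua

/-! ### Chains of open sets -/

section Chains

variable {X : Type*}

/-- The members of `𝒱` reached from `E` by chains of `n + 1` members with consecutive ones
intersecting. -/
def chainLevel (𝒱 : Set (Set X)) (E : Set X) : ℕ → Set (Set X)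
  | 0 => {V ∈ 𝒱 | (V ∩ E).Nonempty}
  | n + 1 => {V ∈ 𝒱 | ∃ V' ∈ chainLevel 𝒱 E n, (V ∩ V').Nonempty}

theorem chainLevel_subset (𝒱 : Set (Set X)) (E : Set X) (n : ℕ) : chainLevel 𝒱 E n ⊆ 𝒱 := by
  cases n <;> exact fun V hV => hV.1

/-- The points reached by chains form an open set that is relatively closed in `G`, because a
covering member that meets a reached one is reached one level later. -/
theorem exists_mem_chainLevel [TopologicalSpace X] {𝒱 : Set (Set X)} {E G : Set X}
    (hG : IsPreconnected G) (hEG : (G ∩ E).Nonempty) (ho : ∀ V ∈ 𝒱, IsOpen V)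
    (hcov : ∀ x ∈ G, ∃ V ∈ 𝒱, x ∈ V) {q : X} (hq : q ∈ G) :
    ∃ n, ∃ V ∈ chainLevel 𝒱 E n, q ∈ V := by
  set S : Set X := {q | ∃ n, ∃ V ∈ chainLevel 𝒱 E n, q ∈ V}
  have hS : IsOpen S := by
    refine isOpen_iff_mem_nhds.2 fun z ⟨n, V, hV, hz⟩ => ?_
    filter_upwards [(ho V (chainLevel_subset _ _ _ hV)).mem_nhds hz] with w hw
    exact ⟨n, V, hV, hw⟩
  refine hG.subset_of_closure_inter_subset hS ?_ ?_ hq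
  · obtain ⟨x, hx, hxE⟩ := hEG
    obtain ⟨V, hV, hxV⟩ := hcov x hx
    exact ⟨x, hx, 0, V, ⟨hV, x, hxV, hxE⟩, hxV⟩
  · rintro y ⟨hy, hyG⟩
    obtain ⟨V, hV, hyV⟩ := hcov y hyG
    obtain ⟨w, hwV, n, V', hV', hw⟩ := mem_closure_iff.1 hy V (ho V hV) hyV
    exact ⟨n + 1, V, ⟨hV, V', hV', w, hwV, hw⟩, hyV⟩

theorem biUnion_lt_succ_ite {N : ℕ} {U : ℕ → Set X} {V : Set X} :
    ⋃ i < N + 1, (if i = N then V else U i) = (⋃ i < N, U i) ∪ V := by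
  ext x
  simp only [mem_iUnion, mem_union, exists_prop]
  constructor
  · rintro ⟨i, hi, hx⟩
    by_cases hiN : i = N
    · exact Or.inr (by simpa [hiN] using hx)
    · exact Or.inl ⟨i, by omega, by simpa [hiN] using hx⟩
  · rintro (⟨i, hi, hx⟩ | hx)
    · exact ⟨i, by omega, by simpa [hi.ne] using hx⟩
    · exact ⟨N, by omega, by simpa using hx⟩

end Chains

/-! ### Forests of small open sets -/

section Forests

variable {X : Type*} [MetricSpace X]

/-- A finite sequence of open sets of diameter at most `δ`, each meeting at most one of its
predecessors. -/
structure IsForest (δ : ℝ) (N : ℕ) (U : ℕ → Set X) : Prop where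
  isOpen : ∀ i < N, IsOpen (U i)
  dist_lt : ∀ i < N, ∀ x ∈ U i, ∀ y ∈ U i, dist x y < δ
  exists_parent : ∀ k < N, ∃ j, ∀ i < k, i ≠ j → Disjoint (U i) (U k)

theorem IsForest.snoc {δ : ℝ} {N : ℕ} {U : ℕ → Set X} (h : IsForest δ N U) {V : Set X}
    (hV : IsOpen V) (hd : ∀ x ∈ V, ∀ y ∈ V, dist x y < δ) {j : ℕ}
    (hj : ∀ i < N, i ≠ j → Disjoint V (U i)) :
    IsForest δ (N + 1) (fun i => if i = N then V else U i) where
  isOpen i hi := by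
    by_cases hiN : i = N
    · simpa [hiN] using hV
    · simpa [hiN] using h.isOpen i (by omega)
  dist_lt i hi := by
    by_cases hiN : i = N
    · simpa [hiN] using hd
    · simpa [hiN] using h.dist_lt i (by omega)
  exists_parent k hk := by
    by_cases hkN : k = N
    · refine ⟨j, fun i hi hij => ?_⟩
      have : i ≠ N := by omega
      simpa [hkN, this] using (hj i (by omega) hij).symm
    · obtain ⟨l, hl⟩ := h.exists_parent k (by omega)
      refine ⟨l, fun i hi hil => ?_⟩
      have : i ≠ N := by omega
      simpa [hkN, this] using hl i hi hil

/-- Attaching to a forest covering `E`, one link at a time, a shortest chain leading away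
from `E`. -/
theorem exists_isForest_of_mem_chainLevel {δ : ℝ} {𝒱 : Set (Set X)} {E G : Set X} {N : ℕ}
    {U : ℕ → Set X} (hU : IsForest δ N U) (hEG : E ⊆ G) (hEo : IsOpen E) (hE : IsPreconnected E)
    (hEU : E ⊆ ⋃ i < N, U i)
    (hV : ∀ V ∈ 𝒱, IsOpen V ∧ IsPreconnected V ∧ V ⊆ G ∧ ∀ x ∈ V, ∀ y ∈ V, dist x y < δ)
    (hVU : ∀ V ∈ 𝒱, (V ∩ E).Nonempty → ∃ i < N, V ⊆ U i) (n : ℕ) :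
    ∀ V ∈ chainLevel 𝒱 E n, (∀ k < n, V ∉ chainLevel 𝒱 E k) →
      ∃ N' U' j, IsForest δ N' U' ∧ j < N' ∧ V ⊆ U' j ∧ IsPreconnected (⋃ i < N', U' i) ∧
        E ⊆ ⋃ i < N', U' i ∧ ⋃ i < N', U' i ⊆ G ∧
        ∀ W ∈ 𝒱, (∀ k ≤ n, W ∉ chainLevel 𝒱 E k) → (∀ i < N', i ≠ j → Disjoint W (U' i)) ∧
          (W ∉ chainLevel 𝒱 E (n + 1) → ∀ i < N', Disjoint W (U' i)) := by
  -- The last clause drives the induction: a member not reached by level `n` can touch only the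
  -- final link `j`, and not even that one unless it belongs to level `n + 1`. So the next link has
  -- a single parent.
  induction n with
  | zero =>
    intro V hV0 _
    obtain ⟨hVV, hVE⟩ := hV0
    obtain ⟨Vo, Vc, VG, Vd⟩ := hV V hVV
    obtain ⟨j, hj, hVj⟩ := hVU V hVV hVE
    -- The old forest is trimmed to `E` and `V` is absorbed into a member already containing it. The
    -- parent condition survives since every set shrinks, and sets disjoint from `E` can now meet
    -- only member `j`.
    have hsub : ∀ i, (if i = j then U i ∩ E ∪ V else U i ∩ E) ⊆ U i := by
      intro i
      split_ifs with h
      · subst h; exact union_subset inter_subset_left hVj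
      · exact inter_subset_left
    have hun : ⋃ i < N, (if i = j then U i ∩ E ∪ V else U i ∩ E) = E ∪ V := by
      ext x
      simp only [mem_iUnion, mem_union, exists_prop]
      constructor
      · rintro ⟨i, hi, hx⟩
        split_ifs at hx with h
        · exact hx.imp (fun h => h.2) id
        · exact Or.inl hx.2
      · rintro (hx | hx)
        · obtain ⟨i, hi, hxi⟩ := mem_iUnion₂.1 (hEU hx)
          refine ⟨i, hi, ?_⟩
          split_ifs
          · exact Or.inl ⟨hxi, hx⟩
          · exact ⟨hxi, hx⟩
        · exact ⟨j, hj, by simp [hx]⟩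
    refine ⟨N, fun i => if i = j then U i ∩ E ∪ V else U i ∩ E, j,
      ⟨fun i hi => ?_, fun i hi x hx y hy => ?_,
      fun k hk => ?_⟩, hj, by simp, ?_, ?_, ?_, ?_⟩
    · split_ifs
      · exact ((hU.isOpen i hi).inter hEo).union Vo
      · exact (hU.isOpen i hi).inter hEo
    · exact hU.dist_lt i hi x (hsub i hx) y (hsub i hy)
    · obtain ⟨l, hl⟩ := hU.exists_parent k hk
      exact ⟨l, fun i hi hil => (hl i hi hil).mono (hsub i) (hsub k)⟩
    · rw [hun]
      obtain ⟨x, hxV, hxE⟩ := hVE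
      exact hE.union x hxE hxV Vc
    · rw [hun]; exact subset_union_left
    · rw [hun]; exact union_subset hEG VG
    · intro W hW hW0
      have hWE : Disjoint W E := by
        rw [disjoint_iff_inter_eq_empty, ← not_nonempty_iff_eq_empty]
        exact fun h => hW0 0 le_rfl ⟨hW, h⟩
      have h1 : ∀ i < N, i ≠ j → Disjoint W (if i = j then U i ∩ E ∪ V else U i ∩ E) := by
        intro i hi hij
        simpa [hij] using hWE.mono_right inter_subset_right
      refine ⟨h1, fun hW1 i hi => ?_⟩
      by_cases hij : i = j
      · have hWV : Disjoint W V := by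
          rw [disjoint_iff_inter_eq_empty, ← not_nonempty_iff_eq_empty]
          exact fun h => hW1 ⟨hW, V, ⟨hVV, hVE⟩, h⟩
        simp only [hij, if_true]
        exact (hWE.mono_right inter_subset_right).union_right hWV
      · exact h1 i hi hij
  | succ n ih =>
    intro V hVn hlt
    obtain ⟨hVV, V', hV'n, hVV'⟩ := hVn
    obtain ⟨Vo, Vc, VG, Vd⟩ := hV V hVV
    -- The predecessor is also reached as early as possible, otherwise `V` would be reached sooner.
    have hlt' : ∀ k < n, V' ∉ chainLevel 𝒱 E k := fun k hk hk' =>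
      hlt (k + 1) (by omega) ⟨hVV, V', hk', hVV'⟩
    obtain ⟨N', U', j, hU', hj, hV'j, hc, hE', hG', hW'⟩ := ih V' hV'n hlt'
    refine ⟨N' + 1, fun i => if i = N' then V else U' i, N',
      hU'.snoc Vo Vd (hW' V hVV fun k hk => hlt k (by omega)).1, by omega, by simp, ?_, ?_, ?_, ?_⟩
    · rw [biUnion_lt_succ_ite]
      obtain ⟨x, hx, hx'⟩ := hVV'
      exact hc.union x (mem_iUnion₂.2 ⟨j, hj, hV'j hx'⟩) hx Vc
    · rw [biUnion_lt_succ_ite]; exact hE'.trans subset_union_left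
    · rw [biUnion_lt_succ_ite]; exact union_subset hG' VG
    · intro W hW hWn
      have h2 := (hW' W hW fun k hk => hWn k (by omega)).2 (hWn (n + 1) le_rfl)
      have h1 : ∀ i < N' + 1, i ≠ N' → Disjoint W (if i = N' then V else U' i) := by
        intro i hi hiN
        simpa [hiN] using h2 i (by omega)
      refine ⟨h1, fun hW1 i hi => ?_⟩
      by_cases hiN : i = N'
      · simp only [hiN, if_true]
        rw [disjoint_iff_inter_eq_empty, ← not_nonempty_iff_eq_empty]
        exact fun h => hW1 ⟨hW, V, ⟨hVV, V', hV'n, hVV'⟩, h⟩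
      · exact h1 i hi hiN

/-- Local connectedness makes the components of small balls centred on `K` open; each meets `K`, so
their union is connected. -/
theorem exists_isOpen_isPreconnected_between {K : Set X} [LocallyConnectedSpace X]
    (hK : IsPreconnected K) {r : ℝ} (hr : 0 < r) :
    ∃ E : Set X, IsOpen E ∧ IsPreconnected E ∧ K ⊆ E ∧ ∀ y ∈ E, ∃ x ∈ K, dist y x < r := by
  rcases K.eq_empty_or_nonempty with rfl | ⟨x₀, hx₀⟩
  · exact ⟨∅, isOpen_empty, isPreconnected_empty, Subset.rfl, by simp⟩
  have hmem : ∀ x : X, x ∈ connectedComponentIn (Metric.ball x r) x := fun x =>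
    mem_connectedComponentIn (Metric.mem_ball_self hr)
  refine ⟨⋃ x ∈ K, connectedComponentIn (Metric.ball x r) x,
    isOpen_biUnion fun x _ => Metric.isOpen_ball.connectedComponentIn, ?_,
    fun x hx => mem_iUnion₂.2 ⟨x, hx, hmem x⟩, fun y hy => ?_⟩
  · refine isPreconnected_of_forall x₀ fun y hy => ?_
    obtain ⟨x, hx, hy⟩ := mem_iUnion₂.1 hy
    refine ⟨K ∪ connectedComponentIn (Metric.ball x r) x, union_subset
      (fun z hz => mem_iUnion₂.2 ⟨z, hz, hmem z⟩) (subset_iUnion₂_of_subset x hx Subset.rfl),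
      Or.inl hx₀, Or.inr hy, hK.union x hx (hmem x) isPreconnected_connectedComponentIn⟩
  · obtain ⟨x, hx, hy⟩ := mem_iUnion₂.1 hy
    exact ⟨x, hx, Metric.mem_ball.1 (connectedComponentIn_subset _ _ hy)⟩

/-- To reach `q` without creating cycles, the forest is first trimmed to a connected neighbourhood
`E` of a continuum `K` containing `F`. A shortest chain of small sets from `E` to `q` is then
attached. -/
theorem exists_isForest_insert [CompactSpace X] [LocallyConnectedSpace X] {δ : ℝ} (hδ : 0 < δ)
    {G F : Set X} (hGo : IsOpen G) (hG : IsPreconnected G) (hF : IsCompact F) (hFn : F.Nonempty)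
    {N : ℕ} {U : ℕ → Set X} (hU : IsForest δ N U) (hUc : IsPreconnected (⋃ i < N, U i))
    (hUG : ⋃ i < N, U i ⊆ G) (hFU : F ⊆ ⋃ i < N, U i) {q : X} (hq : q ∈ G) :
    ∃ N' U', IsForest δ N' U' ∧ IsPreconnected (⋃ i < N', U' i) ∧ ⋃ i < N', U' i ⊆ G ∧
      insert q F ⊆ ⋃ i < N', U' i := by
  have hUo : IsOpen (⋃ i < N, U i) := isOpen_biUnion fun i hi => hU.isOpen i hi
  obtain ⟨K, hKU, hK, hKc, hFK⟩ := exists_isCompact_isPreconnected_superset hUo hUc hF hFU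
  obtain ⟨r, hr, hleb⟩ := lebesgue_number_lemma_of_metric (c := fun i : Fin N => U i) hK
    (fun i => hU.isOpen i i.2) (fun x hx => by
      obtain ⟨i, hi, hx⟩ := mem_iUnion₂.1 (hKU hx)
      exact mem_iUnion.2 ⟨⟨i, hi⟩, hx⟩)
  -- The Lebesgue number `r` is split in two: `E` stays within `r / 2` of `K` and chain members have
  -- diameter at most `r / 2`, so a member meeting `E` lies in a single `U i`.
  obtain ⟨E, hEo, hEc, hKE, hE⟩ := exists_isOpen_isPreconnected_between hKc (half_pos hr)
  have hEU : E ⊆ ⋃ i < N, U i := by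
    intro y hy
    obtain ⟨x, hx, hxy⟩ := hE y hy
    obtain ⟨i, hi⟩ := hleb x hx
    exact mem_iUnion₂.2 ⟨i, i.2, hi (Metric.mem_ball.2 (hxy.trans (half_lt_self hr)))⟩
  set 𝒱 : Set (Set X) := {V | IsOpen V ∧ IsPreconnected V ∧ V ⊆ G ∧
    ∀ x ∈ V, ∀ y ∈ V, dist x y < min δ (r / 2)}
  have hcov : ∀ x ∈ G, ∃ V ∈ 𝒱, x ∈ V := by
    intro x hx
    have hε : 0 < min δ (r / 2) := lt_min hδ (half_pos hr)
    obtain ⟨V, hVs, hVo, hxV, hV⟩ := locallyConnectedSpace_iff_subsets_isOpen_isConnected.1 ‹_› x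
      (G ∩ Metric.ball x (min δ (r / 2) / 2))
      (Filter.inter_mem (hGo.mem_nhds hx) (Metric.ball_mem_nhds x (half_pos hε)))
    refine ⟨V, ⟨hVo, hV.isPreconnected, fun y hy => (hVs hy).1, fun y hy z hz => ?_⟩, hxV⟩
    have h1 := Metric.mem_ball.1 (hVs hy).2
    have h2 := Metric.mem_ball'.1 (hVs hz).2
    linarith [dist_triangle y x z]
  have hVU : ∀ V ∈ 𝒱, (V ∩ E).Nonempty → ∃ i < N, V ⊆ U i := by
    rintro V ⟨-, -, -, hd⟩ ⟨v, hvV, hvE⟩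
    obtain ⟨x, hx, hxv⟩ := hE v hvE
    obtain ⟨i, hi⟩ := hleb x hx
    refine ⟨i, i.2, fun w hw => hi (Metric.mem_ball.2 ?_)⟩
    have := (hd w hw v hvV).trans_le (min_le_right _ _)
    linarith [dist_triangle w v x]
  obtain ⟨x₀, hx₀⟩ := hFn
  have hreach := exists_mem_chainLevel (E := E) hG
    ⟨x₀, hUG (hFU hx₀), hKE (hFK hx₀)⟩ (fun V (hV : V ∈ 𝒱) => hV.1) hcov hq
  classical
  -- The level is the first at which any member contains `q`, which makes `V` itself absent from all
  -- earlier levels.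
  obtain ⟨V, hVn, hqV⟩ := Nat.find_spec hreach
  by_cases hmin : ∀ k < Nat.find hreach, V ∉ chainLevel 𝒱 E k
  · obtain ⟨N', U', j, hU', hj, hVj, hc, hEU', hG', -⟩ := exists_isForest_of_mem_chainLevel hU
      (hEU.trans hUG) hEo hEc hEU
      (fun V (hV : V ∈ 𝒱) => ⟨hV.1, hV.2.1, hV.2.2.1, fun x hx y hy =>
        (hV.2.2.2 x hx y hy).trans_le (min_le_left _ _)⟩) hVU _ V hVn hmin
    exact ⟨N', U', hU', hc, hG', insert_subset (mem_iUnion₂.2 ⟨j, hj, hVj hqV⟩)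
      (hFK.trans (hKE.trans hEU'))⟩
  · push Not at hmin
    obtain ⟨k, hk, hVk⟩ := hmin
    exact absurd ⟨V, hVk, hqV⟩ (Nat.find_min hreach hk)

/-- Finitely many points of a connected open set `G` can be joined inside `G` by a connected
union of a forest of arbitrarily small open sets. -/
theorem exists_isForest_of_finite [CompactSpace X] [LocallyConnectedSpace X] {δ : ℝ} (hδ : 0 < δ)
    {G F : Set X} (hGo : IsOpen G) (hG : IsPreconnected G) (hF : F.Finite) (hFG : F ⊆ G) :
    ∃ N U, IsForest δ N U ∧ IsPreconnected (⋃ i < N, U i) ∧ ⋃ i < N, U i ⊆ G ∧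
      F ⊆ ⋃ i < N, U i := by
  induction F, hF using Set.Finite.induction_on with
  | empty => exact ⟨0, fun _ => ∅, ⟨by simp, by simp, by simp⟩, by simp [isPreconnected_empty],
      by simp, by simp⟩
  | @insert q F hqF hFf ih =>
    obtain ⟨hqG, hFG⟩ := insert_subset_iff.1 hFG
    rcases F.eq_empty_or_nonempty with rfl | hne
    · obtain ⟨V, hVs, hVo, hqV, hV⟩ :=
        locallyConnectedSpace_iff_subsets_isOpen_isConnected.1 ‹_› q (G ∩ Metric.ball q (δ / 2))
          (Filter.inter_mem (hGo.mem_nhds hqG) (Metric.ball_mem_nhds q (half_pos hδ)))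
      have hun : ⋃ i < 1, (fun _ : ℕ => V) i = V := by
        ext x; simp
      refine ⟨1, fun _ => V, ⟨fun _ _ => hVo, fun _ _ y hy z hz => ?_, fun k hk => ⟨0, ?_⟩⟩, ?_⟩
      · have h1 := Metric.mem_ball.1 (hVs hy).2
        have h2 := Metric.mem_ball'.1 (hVs hz).2
        linarith [dist_triangle y q z]
      · intro i hi; omega
      · rw [hun]
        exact ⟨hV.isPreconnected, fun y hy => (hVs hy).1, by simpa using hqV⟩
    · obtain ⟨N, U, hU, hc, hUG, hFU⟩ := ih hFG
      exact exists_isForest_insert hδ hGo hG hFf.isCompact hne hU hc hUG hFU hqG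

end Forests

/-! ### Separating points, and the absence of circles -/

section Separation

/-- Any two distinct points are separated by a third point: it belongs to every connected set
containing both. -/
def CutPointSeparated (X : Type*) [TopologicalSpace X] : Prop :=
  ∀ x y : X, x ≠ y → ∃ z, z ≠ x ∧ z ≠ y ∧ ∀ M, IsPreconnected M → x ∈ M → y ∈ M → z ∈ M

theorem CutPointSeparated.of_homeomorph {X Y : Type*} [TopologicalSpace X] [TopologicalSpace Y]
    (h : CutPointSeparated X) (e : X ≃ₜ Y) : CutPointSeparated Y := by
  intro x y hxy
  obtain ⟨z, hzx, hzy, hz⟩ := h (e.symm x) (e.symm y) (e.symm.injective.ne hxy)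
  refine ⟨e z, fun h => hzx (by simp [← h]), fun h => hzy (by simp [← h]), fun M hM hx hy => ?_⟩
  obtain ⟨w, hw, hwz⟩ := hz (e.symm '' M) (hM.image _ e.symm.continuous.continuousOn)
    (mem_image_of_mem _ hx) (mem_image_of_mem _ hy)
  rw [← hwz]
  simpa using hw

/-- The intersection graph of the first `N` members of a sequence of sets. -/
def intersectionGraph {X : Type*} (N : ℕ) (U : ℕ → Set X) : SimpleGraph (Fin N) where
  Adj i j := i ≠ j ∧ (U i ∩ U j).Nonempty
  symm := ⟨fun i j h => ⟨h.1.symm, by rw [inter_comm]; exact h.2⟩⟩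
  loopless := ⟨fun i h => h.1 rfl⟩

variable {X : Type*} [MetricSpace X] {δ : ℝ} {N : ℕ} {U : ℕ → Set X}

/-- The vertex of largest index on a cycle would have two distinct neighbours of smaller index, but
only one parent is allowed. -/
theorem IsForest.isAcyclic (h : IsForest δ N U) : (intersectionGraph N U).IsAcyclic := by
  intro v c hc
  have hne : c.support.toFinset.Nonempty := ⟨v, by simp⟩
  set m := c.support.toFinset.max' hne
  have hm : m ∈ c.support := List.mem_toFinset.1 (Finset.max'_mem _ hne)
  have hle : ∀ i ∈ c.support, i ≤ m := fun i hi =>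
    Finset.le_max' _ i (List.mem_toFinset.2 hi)
  have hc' := hc.rotate hm
  have hmem : ∀ i ∈ (c.rotate m hm).support, i ∈ c.support := fun i hi => by
    simpa using hi
  have h1 := (c.rotate m hm).adj_snd hc'.not_nil
  have h2 := (c.rotate m hm).adj_penultimate hc'.not_nil
  have h3 := hle _ (hmem _ ((c.rotate m hm).getVert_mem_support 1))
  have h4 := hle _ (hmem _ ((c.rotate m hm).getVert_mem_support ((c.rotate m hm).length - 1)))
  obtain ⟨j, hj⟩ := h.exists_parent m m.2
  have key : ∀ i : Fin N, i ≤ m → i ≠ m → (U i ∩ U m).Nonempty → (i : ℕ) = j := by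
    intro i him hne hi
    by_contra hij
    exact (not_disjoint_iff_nonempty_inter.2 hi) (hj i (lt_of_le_of_ne him (Fin.val_ne_of_ne hne)) hij)
  apply hc'.snd_ne_penultimate
  ext
  rw [key _ h3 h1.1.symm (by rw [inter_comm]; exact h1.2), key _ h4 h2.1 h2.2]

/-- Members reachable by walks through sets meeting `M`, and the remaining members, would otherwise
disconnect `M`. -/
theorem exists_walk_of_isPreconnected (h : IsForest δ N U) {M : Set X} (hM : IsPreconnected M)
    (hMU : M ⊆ ⋃ i < N, U i) {x y : X} (hx : x ∈ M) (hy : y ∈ M) {a b : Fin N} (ha : x ∈ U a)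
    (hb : y ∈ U b) :
    ∃ w : (intersectionGraph N U).Walk a b, ∀ v ∈ w.support, (U v ∩ M).Nonempty := by
  set S : Set (Fin N) := {i | ∃ w : (intersectionGraph N U).Walk a i,
    ∀ v ∈ w.support, (U v ∩ M).Nonempty}
  have haS : a ∈ S := ⟨.nil, by simpa using ⟨x, ha, hx⟩⟩
  by_contra hbS
  obtain ⟨p, hpM, hp1, hp2⟩ := hM (⋃ i ∈ S, U i) (⋃ i ∈ Sᶜ, U i)
    (isOpen_biUnion fun i _ => h.isOpen i i.2) (isOpen_biUnion fun i _ => h.isOpen i i.2)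
    (fun p hp => by
      obtain ⟨i, hi, hpi⟩ := mem_iUnion₂.1 (hMU hp)
      by_cases hiS : (⟨i, hi⟩ : Fin N) ∈ S
      · exact Or.inl (mem_iUnion₂.2 ⟨⟨i, hi⟩, hiS, hpi⟩)
      · exact Or.inr (mem_iUnion₂.2 ⟨⟨i, hi⟩, hiS, hpi⟩))
    ⟨x, hx, mem_iUnion₂.2 ⟨a, haS, ha⟩⟩ ⟨y, hy, mem_iUnion₂.2 ⟨b, hbS, hb⟩⟩
  obtain ⟨i, ⟨w, hw⟩, hpi⟩ := mem_iUnion₂.1 hp1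
  obtain ⟨k, hk, hpk⟩ := mem_iUnion₂.1 hp2
  have hik : i ≠ k := by
    rintro rfl
    exact hk ⟨w, hw⟩
  refine hk ⟨w.concat (show (intersectionGraph N U).Adj i k from ⟨hik, p, hpi, hpk⟩),
    fun v hv => ?_⟩
  rw [SimpleGraph.Walk.support_concat, List.mem_append] at hv
  rcases hv with hv | hv
  · exact hw v hv
  · rw [List.mem_singleton.1 hv]
    exact ⟨p, hpk, hpM⟩

/-- A walk of small sets leaving a ball has a vertex near its boundary sphere. -/
theorem exists_mem_support_dist (h : IsForest δ N U) {x y : X} {r : ℝ} (hr : r + δ ≤ dist x y)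
    {a b : Fin N} (w : (intersectionGraph N U).Walk a b) :
    ∀ p ∈ U a, dist x p ≤ r → y ∈ U b →
      ∃ v ∈ w.support, ∃ q ∈ U v, r < dist x q ∧ dist x q ≤ r + δ := by
  induction w with
  | @nil a =>
    intro p hp hxp hy
    linarith [h.dist_lt a a.2 p hp y hy, dist_triangle x p y]
  | @cons a c b hac w ih =>
    intro p hp hxp hy
    obtain ⟨q, hqa, hqc⟩ := hac.2
    by_cases hq : dist x q ≤ r
    · obtain ⟨v, hv, hv'⟩ := ih q hqc hq hy
      exact ⟨v, by simp [hv], hv'⟩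
    · refine ⟨a, by simp, q, hqa, not_le.1 hq, ?_⟩
      linarith [h.dist_lt a a.2 p hp q hqa, dist_triangle x p q]

/-- In an acyclic graph the path between two vertices is unique, so the path extracted from any
connected `M` visits the same vertex near the sphere of radius `r`. The point `q` depends only on
that vertex, not on `M`. -/
theorem exists_near_every_isPreconnected [PreconnectedSpace X] (h : IsForest δ N U)
    (hU : ⋃ i < N, U i = univ) {x y : X} {r : ℝ} (hr : r + δ ≤ dist x y) (hr0 : 0 ≤ r) :
    ∃ q, r ≤ dist x q ∧ dist x q ≤ r + δ ∧
      ∀ M, IsPreconnected M → x ∈ M → y ∈ M → ∃ p ∈ M, dist p q < δ := by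
  have hcov : ∀ z, ∃ i : Fin N, z ∈ U i := fun z => by
    obtain ⟨i, hi, hz⟩ := mem_iUnion₂.1 (hU.symm ▸ mem_univ z : z ∈ ⋃ i < N, U i)
    exact ⟨⟨i, hi⟩, hz⟩
  obtain ⟨a, ha⟩ := hcov x
  obtain ⟨b, hb⟩ := hcov y
  obtain ⟨w, -⟩ := exists_walk_of_isPreconnected h isPreconnected_univ hU.ge (mem_univ x)
    (mem_univ y) ha hb
  obtain ⟨v, hv, q, hqv, hq1, hq2⟩ := exists_mem_support_dist h hr w.bypass x ha (by simpa) hb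
  refine ⟨q, hq1.le, hq2, fun M hM hx hy => ?_⟩
  obtain ⟨w', hw'⟩ := exists_walk_of_isPreconnected h hM (by rw [hU]; exact subset_univ _) hx hy
    ha hb
  have heq : w.bypass = w'.bypass := congrArg Subtype.val
    ((h.isAcyclic.subsingleton_path a b).elim ⟨w.bypass, w.bypass_isPath⟩
      ⟨w'.bypass, w'.bypass_isPath⟩)
  rw [heq] at hv
  obtain ⟨p, hpv, hpM⟩ := hw' v (w'.support_bypass_subset_support hv)
  exact ⟨p, hpM, h.dist_lt v v.2 p hpv q hqv⟩

/-- A locally connected continuum covered by forests of arbitrarily small open sets has any two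
of its points separated by a third one. -/
theorem cutPointSeparated_of_isForest [CompactSpace X] [PreconnectedSpace X]
    [LocallyConnectedSpace X]
    (h : ∀ δ > 0, ∃ N, ∃ U : ℕ → Set X, IsForest δ N U ∧ ⋃ i < N, U i = univ) :
    CutPointSeparated X := by
  intro x y hxy
  have hd : 0 < dist x y := dist_pos.2 hxy
  -- The bound `dist x y / 4` keeps the points `q n` at distance between 1/2 and 3/4 of `dist x y`
  -- from `x`, so that their limit differs from both endpoints.
  set δ : ℕ → ℝ := fun n => min (1 / ((n : ℝ) + 1)) (dist x y / 4)
  have hδ : ∀ n, 0 < δ n := fun n => lt_min Nat.one_div_pos_of_nat (by linarith)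
  have hq : ∀ n : ℕ, ∃ q, dist x y / 2 ≤ dist x q ∧ dist x q ≤ 3 * dist x y / 4 ∧
      ∀ M, IsPreconnected M → x ∈ M → y ∈ M → ∃ p ∈ M, dist p q < 1 / ((n : ℝ) + 1) := by
    intro n
    have h4 : δ n ≤ dist x y / 4 := min_le_right _ _
    obtain ⟨N, U, hU, hUu⟩ := h (δ n) (hδ n)
    obtain ⟨q, h1, h2, h3⟩ := exists_near_every_isPreconnected hU hUu (x := x) (y := y)
      (r := dist x y / 2) (by linarith) (by linarith)
    refine ⟨q, h1, by linarith, fun M hM hx hy => ?_⟩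
    obtain ⟨p, hp, hpq⟩ := h3 M hM hx hy
    exact ⟨p, hp, hpq.trans_le (min_le_left _ _)⟩
  choose q h1 h2 h3 using hq
  obtain ⟨z, φ, hφ, hz⟩ := CompactSpace.tendsto_subseq q
  have hdz : Filter.Tendsto (fun n => dist x (q (φ n))) Filter.atTop (𝓝 (dist x z)) :=
    tendsto_const_nhds.dist hz
  have hz1 : dist x y / 2 ≤ dist x z := ge_of_tendsto' hdz fun n => h1 _
  have hz2 : dist x z ≤ 3 * dist x y / 4 := le_of_tendsto' hdz fun n => h2 _
  refine ⟨z, ?_, ?_, fun M hM hx hy => ?_⟩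
  · rintro rfl
    rw [dist_self] at hz1
    linarith
  · rintro rfl
    linarith
  -- The set `M` need not be closed, so it is replaced by a compact connected `L` through `x` and
  -- `y` that still misses `z`. Then `L` is at positive distance from `z`, yet comes arbitrarily
  -- close to the points `q (φ n)` tending to `z`.
  · by_contra hzM
    have hME : M ⊆ {z}ᶜ := fun p hp hpz => hzM (hpz ▸ hp)
    have hsub := hM.subset_connectedComponentIn hx hME
    obtain ⟨L, hLE, hL, hLc, hxyL⟩ := exists_isCompact_isPreconnected_superset
      (isOpen_compl_singleton.connectedComponentIn (x := x)) isPreconnected_connectedComponentIn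
      ((isCompact_singleton (x := y)).insert x)
      (insert_subset (hsub hx) (singleton_subset_iff.2 (hsub hy)))
    have hzL : z ∈ Lᶜ := fun hz => connectedComponentIn_subset _ _ (hLE hz) rfl
    obtain ⟨η, hη, hball⟩ := Metric.isOpen_iff.1 hL.isClosed.isOpen_compl z hzL
    have e1 : ∀ᶠ n in Filter.atTop, dist (q (φ n)) z < η / 2 :=
      Metric.tendsto_nhds.1 hz _ (half_pos hη)
    have e2 : ∀ᶠ n in Filter.atTop, 1 / (((φ n : ℕ) : ℝ) + 1) < η / 2 :=
      (tendsto_one_div_add_atTop_nhds_zero_nat.comp hφ.tendsto_atTop).eventually_lt_const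
        (half_pos hη)
    obtain ⟨n, hn1, hn2⟩ := (e1.and e2).exists
    obtain ⟨p, hp, hpq⟩ := h3 (φ n) L hLc (hxyL (by simp)) (hxyL (by simp))
    refine hball (Metric.mem_ball.2 ?_) hp
    linarith [dist_triangle p (q (φ n)) z]

theorem isPreconnected_compl_singleton_circle (c : Circle) : IsPreconnected ({c}ᶜ : Set Circle) := by
  -- The rotation by `c * Circle.exp Real.pi` sends the excluded parameter values ±π to `c`.
  have : ({c}ᶜ : Set Circle) =
      (fun t : ℝ => c * Circle.exp Real.pi * Circle.exp t) '' Ioo (-Real.pi) Real.pi := by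
    have hpi : Circle.exp Real.pi * Circle.exp Real.pi = 1 := by
      rw [← Circle.exp_add, ← two_mul, Circle.exp_two_pi]
    ext w
    simp only [mem_compl_iff, mem_singleton_iff, mem_image, mem_Ioo]
    constructor
    · intro hw
      obtain ⟨hl, hu⟩ := Complex.arg_mem_Ioc ((w * c⁻¹ * Circle.exp Real.pi : Circle) : ℂ)
      have he := Circle.exp_arg (w * c⁻¹ * Circle.exp Real.pi)
      refine ⟨_, ⟨hl, lt_of_le_of_ne hu fun h => hw ?_⟩, ?_⟩
      · rw [h] at he
        have := mul_right_cancel ((one_mul _).trans he)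
        exact (mul_inv_eq_one.1 this.symm)
      · rw [he]
        calc c * Circle.exp Real.pi * (w * c⁻¹ * Circle.exp Real.pi)
            = c * c⁻¹ * w * (Circle.exp Real.pi * Circle.exp Real.pi) := by
              simp only [mul_comm, mul_left_comm, mul_assoc]
          _ = w := by rw [hpi]; simp
    · rintro ⟨t, ⟨hl, hu⟩, rfl⟩ h
      rw [mul_assoc, mul_eq_left] at h
      have h2 : Circle.exp t = Circle.exp Real.pi :=
        mul_left_cancel (a := Circle.exp Real.pi) (h.trans hpi.symm)
      exact hu.ne (Circle.invOn_arg_exp.1.injOn ⟨hl, hu.le⟩ ⟨by linarith [Real.pi_pos], le_rfl⟩ h2)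
  rw [this]
  exact isPreconnected_Ioo.image _ (by fun_prop)

/-- A separating point of two points on a circle would lie on the circle, but deleting it leaves a
connected set that still contains both. -/
theorem CutPointSeparated.no_simple_closed_curve {X : Type*} [TopologicalSpace X]
    (h : CutPointSeparated X) (S : Set X) : ¬ Nonempty (Circle ≃ₜ S) := by
  rintro ⟨e⟩
  have hne : (Circle.exp 0 : Circle) ≠ Circle.exp Real.pi := fun h =>
    Real.pi_pos.ne (Circle.invOn_arg_exp.1.injOn ⟨by linarith [Real.pi_pos], Real.pi_pos.le⟩
      ⟨by linarith [Real.pi_pos], le_rfl⟩ h)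
  have hcont : Continuous fun c => (e c : X) := continuous_subtype_val.comp e.continuous
  have hinj : Function.Injective fun c => (e c : X) := Subtype.val_injective.comp e.injective
  obtain ⟨z, hz0, hz1, hz⟩ := h (e (Circle.exp 0)) (e (Circle.exp Real.pi)) (hinj.ne hne)
  have hrange : range (fun c => (e c : X)) = S := by
    rw [show (fun c => (e c : X)) = Subtype.val ∘ e from rfl, range_comp, e.surjective.range_eq,
      image_univ, Subtype.range_coe]
  have hzS : z ∈ S := hrange ▸ hz _ (isPreconnected_range hcont) ⟨_, rfl⟩ ⟨_, rfl⟩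
  obtain ⟨c, hc⟩ := e.surjective ⟨z, hzS⟩
  have hcz : (e c : X) = z := by rw [hc]
  have hmem : ∀ d, (e d : X) ≠ z → (e d : X) ∈ (fun c => (e c : X)) '' {c}ᶜ := fun d hd =>
    ⟨d, fun h => hd (by rw [mem_singleton_iff.1 h, hcz]), rfl⟩
  obtain ⟨d, hd, hdz⟩ := hz _ ((isPreconnected_compl_singleton_circle c).image _
    hcont.continuousOn) (hmem _ hz0.symm) (hmem _ hz1.symm)
  exact hd (hinj (hdz.trans hcz.symm))

end Separation

/-! ### Components of the complement of a point -/

section Components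

variable {X : Type u} [TopologicalSpace X]

/-- The components of the complement of a point. -/
def componentsOff (p : X) : Set (Set X) :=
  connectedComponentIn {p}ᶜ '' {p}ᶜ

theorem notMem_of_mem_componentsOff {p : X} {C : Set X} (hC : C ∈ componentsOff p) : p ∉ C := by
  obtain ⟨x, -, rfl⟩ := hC
  exact fun h => connectedComponentIn_subset _ _ h rfl

theorem isPreconnected_of_mem_componentsOff {p : X} {C : Set X} (hC : C ∈ componentsOff p) :
    IsPreconnected C := by
  obtain ⟨x, -, rfl⟩ := hC
  exact isPreconnected_connectedComponentIn

theorem nonempty_of_mem_componentsOff {p : X} {C : Set X} (hC : C ∈ componentsOff p) :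
    C.Nonempty := by
  obtain ⟨x, hx, rfl⟩ := hC
  exact ⟨x, mem_connectedComponentIn hx⟩

theorem eq_of_mem_componentsOff {p x : X} {C : Set X} (hC : C ∈ componentsOff p) (hx : x ∈ C) :
    C = connectedComponentIn {p}ᶜ x := by
  obtain ⟨y, -, rfl⟩ := hC
  exact connectedComponentIn_eq hx

theorem isOpen_of_mem_componentsOff [T1Space X] [LocallyConnectedSpace X] {p : X} {C : Set X}
    (hC : C ∈ componentsOff p) : IsOpen C := by
  obtain ⟨x, -, rfl⟩ := hC
  exact isOpen_compl_singleton.connectedComponentIn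

theorem connectedComponentIn_mem_componentsOff {p x : X} (hx : x ≠ p) :
    connectedComponentIn {p}ᶜ x ∈ componentsOff p :=
  ⟨x, hx, rfl⟩

theorem pairwiseDisjoint_componentsOff (p : X) : (componentsOff p).PairwiseDisjoint id := by
  intro C hC C' hC' hne
  refine Set.disjoint_left.2 fun x hx hx' => hne ?_
  rw [eq_of_mem_componentsOff hC hx, eq_of_mem_componentsOff hC' hx']

theorem IsPreconnected.inter_frontier_nonempty {M V : Set X} (hM : IsPreconnected M)
    (hV : IsOpen V) (h1 : (M ∩ V).Nonempty) (h2 : ¬ M ⊆ V) : (M ∩ frontier V).Nonempty := by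
  by_contra h
  refine h2 (hM.subset_of_closure_inter_subset hV h1 fun x hx => ?_)
  by_contra hxV
  exact h ⟨x, hx.2, by rw [hV.frontier_eq]; exact ⟨hx.1, hxV⟩⟩

theorem frontier_connectedComponentIn_subset [LocallyConnectedSpace X] {U : Set X} (hU : IsOpen U)
    (x : X) : frontier (connectedComponentIn U x) ⊆ Uᶜ := by
  intro y hy hyU
  rw [hU.connectedComponentIn.frontier_eq] at hy
  obtain ⟨z, hz1, hz2⟩ := mem_closure_iff.1 hy.1 (connectedComponentIn U y)
    hU.connectedComponentIn (mem_connectedComponentIn hyU)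
  apply hy.2
  rw [connectedComponentIn_eq hz2, ← connectedComponentIn_eq hz1]
  exact mem_connectedComponentIn hyU

variable [T1Space X] [LocallyConnectedSpace X]

theorem closure_subset_insert_of_mem_componentsOff {p : X} {C : Set X}
    (hC : C ∈ componentsOff p) : closure C ⊆ insert p C := by
  intro y hy
  by_cases hyC : y ∈ C
  · exact Or.inr hyC
  obtain ⟨x, -, rfl⟩ := hC
  have := frontier_connectedComponentIn_subset isOpen_compl_singleton x
    (show y ∈ frontier _ from ⟨hy, fun h => hyC (interior_subset h)⟩)
  exact Or.inl (by simpa using this)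

theorem mem_closure_of_mem_componentsOff [PreconnectedSpace X] {p : X} {C : Set X}
    (hC : C ∈ componentsOff p) : p ∈ closure C := by
  have hpC := notMem_of_mem_componentsOff hC
  obtain ⟨y, hy⟩ := nonempty_frontier_iff.2 ⟨nonempty_of_mem_componentsOff hC,
    fun h => hpC (h ▸ mem_univ p)⟩
  rw [(isOpen_of_mem_componentsOff hC).frontier_eq] at hy
  rcases closure_subset_insert_of_mem_componentsOff hC hy.1 with rfl | h
  · exact hy.1
  · exact absurd h hy.2

theorem isPreconnected_insert_of_mem_componentsOff [PreconnectedSpace X] {p : X} {C : Set X}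
    (hC : C ∈ componentsOff p) : IsPreconnected (insert p C) :=
  (isPreconnected_of_mem_componentsOff hC).subset_closure (subset_insert _ _)
    (insert_subset (mem_closure_of_mem_componentsOff hC) subset_closure)

theorem countable_componentsOff [SeparableSpace X] (p : X) : (componentsOff p).Countable :=
  (pairwiseDisjoint_componentsOff p).countable_of_isOpen
    (fun _ hC => isOpen_of_mem_componentsOff hC) fun _ hC => nonempty_of_mem_componentsOff hC

/-- The components are open and disjoint, and finitely many of them cover the compact set `Uᶜ`. -/
theorem finite_componentsOff_inter [CompactSpace X] {p : X} {U : Set X} (hU : IsOpen U)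
    (hp : p ∈ U) : {C ∈ componentsOff p | (C ∩ Uᶜ).Nonempty}.Finite := by
  have hne : ∀ x ∈ Uᶜ, x ≠ p := fun x hx h => hx (h ▸ hp)
  obtain ⟨t, htU, ht⟩ := hU.isClosed_compl.isCompact.elim_nhds_subcover
    (connectedComponentIn {p}ᶜ) fun x hx =>
      connectedComponentIn_mem_nhds (isOpen_compl_singleton.mem_nhds (hne x hx))
  refine (t.finite_toSet.image (connectedComponentIn {p}ᶜ)).subset ?_
  rintro C ⟨hC, x, hxC, hxU⟩
  obtain ⟨y, hy, hxy⟩ := mem_iUnion₂.1 (ht hxU)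
  exact ⟨y, hy, by rw [eq_of_mem_componentsOff hC hxC, connectedComponentIn_eq hxy]⟩

/-- Two points lying in components at `p` which miss `q` lie in the same component at `q`. -/
theorem connectedComponentIn_eq_of_notMem [PreconnectedSpace X] {p q x y : X} (hpq : p ≠ q)
    (hx : x ≠ p) (hy : y ≠ p) (hqx : q ∉ connectedComponentIn {p}ᶜ x)
    (hqy : q ∉ connectedComponentIn {p}ᶜ y) :
    connectedComponentIn {q}ᶜ x = connectedComponentIn {q}ᶜ y := by
  have h1 := isPreconnected_insert_of_mem_componentsOff (connectedComponentIn_mem_componentsOff hx)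
  have h2 := isPreconnected_insert_of_mem_componentsOff (connectedComponentIn_mem_componentsOff hy)
  have hx' : x ∈ connectedComponentIn {p}ᶜ x := mem_connectedComponentIn hx
  have hy' : y ∈ connectedComponentIn {p}ᶜ y := mem_connectedComponentIn hy
  have hun := h1.union p (mem_insert _ _) (mem_insert _ _) h2
  refine connectedComponentIn_eq (hun.subset_connectedComponentIn (Or.inl (Or.inr hx')) ?_
    (Or.inr (Or.inr hy')))
  rintro z hz rfl
  rcases hz with (h | h) | (h | h)
  exacts [hpq h.symm, hqx h, hpq h.symm, hqy h]

/-- A connected separable space has at most countably many points whose complement has at least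
three components. -/
theorem countable_setOf_three_le_componentsOff [PreconnectedSpace X] [SeparableSpace X] :
    {p : X | 3 ≤ Cardinal.mk (componentsOff p)}.Countable := by
  cases isEmpty_or_nonempty X
  · exact Set.to_countable _
  -- Each such point is coded by three indices of a dense sequence, one for each of three distinct
  -- components; the code turns out to be injective.
  have key : ∀ p ∈ {p : X | 3 ≤ Cardinal.mk (componentsOff p)}, ∃ i : ℕ × ℕ × ℕ,
      (denseSeq X i.1 ≠ p ∧ denseSeq X i.2.1 ≠ p ∧ denseSeq X i.2.2 ≠ p) ∧
      connectedComponentIn {p}ᶜ (denseSeq X i.1) ≠ connectedComponentIn {p}ᶜ (denseSeq X i.2.1) ∧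
      connectedComponentIn {p}ᶜ (denseSeq X i.1) ≠ connectedComponentIn {p}ᶜ (denseSeq X i.2.2) ∧
      connectedComponentIn {p}ᶜ (denseSeq X i.2.1) ≠
        connectedComponentIn {p}ᶜ (denseSeq X i.2.2) := by
    intro p hp
    have hp3 : 3 ≤ Cardinal.mk (componentsOff p) := hp
    obtain ⟨C₁, C₂, h12⟩ := Cardinal.two_le_iff.1 (le_trans (by norm_num) hp3)
    obtain ⟨C₃, h31, h32⟩ := Cardinal.exists_ne_ne_of_three_le hp3 C₁ C₂
    have h13 := h31.symm
    have h23 := h32.symm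
    have hex : ∀ C : componentsOff p, ∃ i, denseSeq X i ∈ (C : Set X) := fun C =>
      (denseRange_denseSeq X).exists_mem_open (isOpen_of_mem_componentsOff C.2)
        (nonempty_of_mem_componentsOff C.2)
    choose f hf using hex
    have hfe : ∀ C, connectedComponentIn {p}ᶜ (denseSeq X (f C)) = C := fun C =>
      (eq_of_mem_componentsOff C.2 (hf C)).symm
    have hfn : ∀ C, denseSeq X (f C) ≠ p := fun C h => by
      have hC := hf C
      rw [h] at hC
      exact notMem_of_mem_componentsOff C.2 hC
    refine ⟨(f C₁, f C₂, f C₃), ⟨hfn _, hfn _, hfn _⟩, ?_, ?_, ?_⟩ <;>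
    · simp only [hfe]
      exact Subtype.coe_injective.ne ‹_›
  choose! f hf1 hf2 using key
  refine Set.countable_of_injective_of_countable_image (f := f) (fun p hp q hq hpq => ?_)
    (Set.to_countable _)
  by_contra hne
  obtain ⟨p1, p2, p3⟩ := hf1 p hp
  obtain ⟨d12, d13, d23⟩ := hf2 p hp
  obtain ⟨e12, e13, e23⟩ := hf2 q hq
  rw [← hpq] at e12 e13 e23
  have huniq : ∀ a b, connectedComponentIn {p}ᶜ a ≠ connectedComponentIn {p}ᶜ b →
      q ∈ connectedComponentIn {p}ᶜ a → q ∉ connectedComponentIn {p}ᶜ b := fun a b hab ha hb =>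
    hab ((connectedComponentIn_eq ha).trans (connectedComponentIn_eq hb).symm)
  -- If `p` and `q` share a code, `q` lies in at most one of the three components at `p`. The other
  -- two are then joined through `p` in the complement of `q`, contradicting their distinctness at
  -- `q`.
  by_cases h1 : q ∈ connectedComponentIn {p}ᶜ (denseSeq X (f p).1)
  · exact e23 (connectedComponentIn_eq_of_notMem hne p2 p3 (huniq _ _ d12 h1) (huniq _ _ d13 h1))
  · by_cases h2 : q ∈ connectedComponentIn {p}ᶜ (denseSeq X (f p).2.1)
    · exact e13 (connectedComponentIn_eq_of_notMem hne p1 p3 h1 (huniq _ _ d23 h2))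
    · exact e12 (connectedComponentIn_eq_of_notMem hne p1 p2 h1 h2)

end Components

/-! ### Order as the number of complementary components -/

section Order

variable {X : Type u} [TopologicalSpace X]

theorem order_le_of_homeomorph {Y : Type u} [TopologicalSpace Y] (e : X ≃ₜ Y) (x : X) :
    order (e x) ≤ order x := by
  have hne : {κ : Cardinal.{u} | ∀ U : Set X, IsOpen U → x ∈ U →
      ∃ V : Set X, IsOpen V ∧ x ∈ V ∧ V ⊆ U ∧ Cardinal.mk (frontier V) ≤ κ}.Nonempty :=
    ⟨Cardinal.mk X, fun U hU hx => ⟨U, hU, hx, Subset.rfl, Cardinal.mk_set_le _⟩⟩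
  refine le_csInf hne fun κ hκ => csInf_le' fun U hU hx => ?_
  obtain ⟨V, hV, hxV, hVU, hc⟩ := hκ (e ⁻¹' U) (hU.preimage e.continuous) hx
  refine ⟨e '' V, e.isOpen_image.2 hV, mem_image_of_mem e hxV, image_subset_iff.2 hVU, ?_⟩
  rw [← e.image_frontier]
  exact Cardinal.mk_image_le.trans hc

theorem order_homeomorph {Y : Type u} [TopologicalSpace Y] (e : X ≃ₜ Y) (x : X) :
    order (e x) = order x :=
  (order_le_of_homeomorph e x).antisymm
    (by simpa using order_le_of_homeomorph e.symm (e x))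

/-- A component at `p` has a closed part away from `p` cut off by a neighbourhood of `p` with a
single boundary point. -/
theorem CutPointSeparated.exists_frontier_subset_singleton [T2Space X] [CompactSpace X]
    [PreconnectedSpace X] [LocallyConnectedSpace X] (hX : CutPointSeparated X) {p : X} {C F : Set X}
    (hC : C ∈ componentsOff p) (hF : IsCompact F) (hFn : F.Nonempty) (hFC : F ⊆ C) :
    ∃ z, ∃ V : Set X, IsOpen V ∧ p ∈ V ∧ frontier V ⊆ {z} ∧ Disjoint V F := by
  obtain ⟨M, hMC, hM, hMc, hFM⟩ := exists_isCompact_isPreconnected_superset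
    (isOpen_of_mem_componentsOff hC) (isPreconnected_of_mem_componentsOff hC) hF hFC
  have hpM : p ∈ Mᶜ := fun h => notMem_of_mem_componentsOff hC (hMC h)
  have hMo : IsOpen Mᶜ := hM.isClosed.isOpen_compl
  set W := connectedComponentIn Mᶜ p
  have hpW : p ∈ W := mem_connectedComponentIn hpM
  have hWM : ∀ w ∈ W, w ∉ M := fun w hw => connectedComponentIn_subset _ _ hw
  obtain ⟨x, hx⟩ := hFn
  obtain ⟨m, hm⟩ := nonempty_frontier_iff.2 ⟨⟨p, hpW⟩,
    fun h => hWM x (h ▸ mem_univ x) (hFM hx)⟩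
  have hmM : m ∈ M := by
    simpa using frontier_connectedComponentIn_subset hMo p hm
  -- Here `W ∪ {m}` is connected, which forces `z` into `W` and thus off `M`. If the component of
  -- `p` in `{z}ᶜ` met `F`, its union with `M` would join `p` to `m` while avoiding `z`.
  obtain ⟨z, hzp, hzm, hz⟩ := hX p m (fun h => hpM (h ▸ hmM))
  have hzW : z ∈ W := by
    have hc : IsPreconnected (insert m W) := isPreconnected_connectedComponentIn.subset_closure
      (subset_insert _ _) (insert_subset (frontier_subset_closure hm) subset_closure)
    exact (hz _ hc (Or.inr hpW) (Or.inl rfl)).resolve_left hzm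
  have hpV : p ∈ connectedComponentIn {z}ᶜ p := mem_connectedComponentIn hzp.symm
  refine ⟨z, connectedComponentIn {z}ᶜ p, isOpen_compl_singleton.connectedComponentIn, hpV, ?_, ?_⟩
  · simpa using frontier_connectedComponentIn_subset (isOpen_compl_singleton (x := z)) p
  · refine Set.disjoint_left.2 fun f hfV hfF => ?_
    rcases hz _ (isPreconnected_connectedComponentIn.union f hfV (hFM hfF) hMc) (Or.inl hpV)
      (Or.inr hmM) with h | h
    · exact connectedComponentIn_subset _ _ h rfl
    · exact hWM z hzW h

/-- Only finitely many components at `p` leave `U`. Each is cut off at the cost of one boundary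
point, and the cutting neighbourhoods are intersected. -/
theorem CutPointSeparated.exists_frontier_le [T2Space X] [CompactSpace X]
    [PreconnectedSpace X] [LocallyConnectedSpace X] (hX : CutPointSeparated X) {p : X} {U : Set X}
    (hU : IsOpen U) (hp : p ∈ U) :
    ∃ V : Set X, IsOpen V ∧ p ∈ V ∧ V ⊆ U ∧
      Cardinal.mk (frontier V) ≤ Cardinal.mk (componentsOff p) := by
  have key : ∀ C ∈ {C ∈ componentsOff p | (C ∩ Uᶜ).Nonempty},
      ∃ z, ∃ V : Set X, IsOpen V ∧ p ∈ V ∧ frontier V ⊆ {z} ∧ Disjoint V (C ∩ Uᶜ) := by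
    rintro C ⟨hC, hCU⟩
    refine hX.exists_frontier_subset_singleton hC ?_ hCU inter_subset_left
    have : C ∩ Uᶜ = closure C ∩ Uᶜ := by
      refine (inter_subset_inter_left _ subset_closure).antisymm fun x hx => ⟨?_, hx.2⟩
      rcases closure_subset_insert_of_mem_componentsOff hC hx.1 with rfl | h
      exacts [absurd hp hx.2, h]
    rw [this]
    exact (isClosed_closure.inter hU.isClosed_compl).isCompact
  have : Nonempty X := ⟨p⟩
  choose! z V hVo hpV hVz hVU using key
  have hfin := finite_componentsOff_inter hU hp
  set T := {C ∈ componentsOff p | (C ∩ Uᶜ).Nonempty}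
  have hWo : IsOpen (⋂ C ∈ T, V C) := hfin.isOpen_biInter hVo
  refine ⟨⋂ C ∈ T, V C, hWo, mem_iInter₂.2 hpV, fun x hx => ?_, ?_⟩
  · by_contra hxU
    have hxp : x ≠ p := fun h => hxU (h ▸ hp)
    have hxC : x ∈ connectedComponentIn {p}ᶜ x := mem_connectedComponentIn hxp
    have hCT : connectedComponentIn {p}ᶜ x ∈ T :=
      ⟨connectedComponentIn_mem_componentsOff hxp, x, hxC, hxU⟩
    exact Set.disjoint_left.1 (hVU _ hCT) (mem_iInter₂.1 hx _ hCT) ⟨hxC, hxU⟩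
  · have hsub : frontier (⋂ C ∈ T, V C) ⊆ z '' T := by
      intro x hx
      rw [hWo.frontier_eq] at hx
      obtain ⟨C, hC, hxC⟩ : ∃ C ∈ T, x ∉ V C := by simpa using hx.2
      refine ⟨C, hC, (hVz C hC ?_).symm⟩
      rw [(hVo C hC).frontier_eq]
      exact ⟨closure_mono (biInter_subset_of_mem hC) hx.1, hxC⟩
    exact (Cardinal.mk_le_mk_of_subset hsub).trans
      (Cardinal.mk_image_le.trans (Cardinal.mk_le_mk_of_subset (sep_subset _ _)))

/-- Each chosen component, with `p` added, is connected and leaves `V`, so it contains a frontier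
point of its own. This is the lower bound for the order. -/
theorem mk_le_mk_frontier [T1Space X] [PreconnectedSpace X] [LocallyConnectedSpace X] {p : X}
    {T : Set (Set X)} (hT : T ⊆ componentsOff p) {x : Set X → X} (hx : ∀ C ∈ T, x C ∈ C)
    {V : Set X} (hV : IsOpen V) (hpV : p ∈ V) (hVx : ∀ C ∈ T, x C ∉ V) :
    Cardinal.mk T ≤ Cardinal.mk (frontier V) := by
  have key : ∀ C : T, ∃ y : frontier V, (y : X) ∈ (C : Set X) := by
    rintro ⟨C, hC⟩
    obtain ⟨y, hy, hyV⟩ := IsPreconnected.inter_frontier_nonempty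
      (isPreconnected_insert_of_mem_componentsOff (hT hC)) hV ⟨p, Or.inl rfl, hpV⟩
      fun h => hVx C hC (h (Or.inr (hx C hC)))
    rcases hy with rfl | hy
    · rw [hV.frontier_eq] at hyV
      exact absurd hpV hyV.2
    · exact ⟨⟨y, hyV⟩, hy⟩
  choose y hy using key
  refine Cardinal.mk_le_of_injective (f := y) fun C C' h => Subtype.ext ?_
  by_contra hne
  exact Set.disjoint_left.1 (pairwiseDisjoint_componentsOff p (hT C.2) (hT C'.2) hne) (hy C)
    (h ▸ hy C')

/-- In a locally connected continuum whose points are separated by points, the order of a point is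
the number of components of its complement. -/
theorem CutPointSeparated.order_eq [T2Space X] [CompactSpace X] [SeparableSpace X]
    [PreconnectedSpace X] [LocallyConnectedSpace X] (hX : CutPointSeparated X) (p : X) :
    order p = Cardinal.mk (componentsOff p) := by
  refine le_antisymm (csInf_le' fun U hU hp => hX.exists_frontier_le hU hp)
    (le_csInf ⟨_, fun U hU hp => hX.exists_frontier_le hU hp⟩ fun κ hκ => ?_)
  by_contra! hlt
  -- A bound below the countable number of components is a finite `n`. Choosing `n + 1` components
  -- and a neighbourhood of `p` avoiding one point of each forces `n + 1` boundary points.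
  obtain ⟨n, rfl⟩ := Cardinal.lt_aleph0.1
    (hlt.trans_le (Cardinal.le_aleph0_iff_set_countable.2 (countable_componentsOff p)))
  have hle : ((n + 1 : ℕ) : Cardinal.{u}) ≤ Cardinal.mk (componentsOff p) := by
    rw [Nat.cast_succ, ← Cardinal.succ_natCast]
    exact Order.succ_le_of_lt hlt
  obtain ⟨T, hT, hTn⟩ := Cardinal.le_mk_iff_exists_subset.1 hle
  have hTfin : T.Finite := Cardinal.lt_aleph0_iff_set_finite.1 (hTn ▸ Cardinal.natCast_lt_aleph0)
  have : Nonempty X := ⟨p⟩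
  choose! x hx using fun C (hC : C ∈ T) => nonempty_of_mem_componentsOff (hT hC)
  obtain ⟨V, hV, hpV, hVU, hc⟩ := hκ (x '' T)ᶜ (hTfin.image x).isClosed.isOpen_compl (by
    rintro ⟨C, hC, rfl⟩
    exact notMem_of_mem_componentsOff (hT hC) (hx C hC))
  have := (mk_le_mk_frontier hT hx hV hpV fun C hC h => hVU h (mem_image_of_mem x hC)).trans hc
  rw [hTn] at this
  exact absurd (Nat.cast_le.1 this) (by omega)

end Order

/-! ### Comparing components in a subcontinuum and in the whole space -/

section Subcontinua

variable {X : Type u} [TopologicalSpace X] {K : Set X}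

theorem image_val_subset_connectedComponentIn {p a b : K}
    (h : b ∈ connectedComponentIn {p}ᶜ a) (ha : a ≠ p) :
    (b : X) ∈ connectedComponentIn {(p : X)}ᶜ a := by
  refine (isPreconnected_connectedComponentIn.image Subtype.val
    continuous_subtype_val.continuousOn).subset_connectedComponentIn
    (mem_image_of_mem _ (mem_connectedComponentIn (F := {p}ᶜ) ha)) ?_ (mem_image_of_mem _ h)
  rintro _ ⟨c, hc, rfl⟩ hcp
  exact connectedComponentIn_subset _ _ hc (Subtype.ext hcp)

/-- Points of a locally connected subcontinuum `K` in the same component of `X \ {p}` lie in the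
same component of `K \ {p}`. -/
theorem CutPointSeparated.connectedComponentIn_eq [T2Space X] [CompactSpace X]
    [LocallyConnectedSpace X] (hX : CutPointSeparated X) [PreconnectedSpace K]
    [LocallyConnectedSpace K] {p a b : K} (ha : a ≠ p) (hb : b ≠ p)
    (hab : (b : X) ∈ connectedComponentIn {(p : X)}ᶜ a) :
    connectedComponentIn {p}ᶜ a = connectedComponentIn {p}ᶜ b := by
  have ha' : (a : X) ≠ p := fun h => ha (Subtype.ext h)
  obtain ⟨M, hMC, hM, hMc, hMab⟩ := exists_isCompact_isPreconnected_superset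
    ((isOpen_compl_singleton (x := (p : X))).connectedComponentIn (x := (a : X)))
    isPreconnected_connectedComponentIn ((isCompact_singleton (x := (b : X))).insert (a : X))
    (insert_subset (mem_connectedComponentIn ha') (singleton_subset_iff.2 hab))
  have hpM : (p : X) ∉ M := fun h => connectedComponentIn_subset _ _ (hMC h) rfl
  have hMo : IsOpen (((↑) : K → X) ⁻¹' M)ᶜ :=
    (hM.isClosed.preimage continuous_subtype_val).isOpen_compl
  set Q := connectedComponentIn (((↑) : K → X) ⁻¹' M)ᶜ p
  have hpQ : p ∈ Q := mem_connectedComponentIn hpM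
  have hQM : ∀ q ∈ Q, (q : X) ∉ M := fun q hq => connectedComponentIn_subset _ _ hq
  have hQo : IsOpen Q := hMo.connectedComponentIn
  have key : ∀ c : K, c ≠ p → (c : X) ∈ M →
      ∃ u ∈ connectedComponentIn {p}ᶜ c, u ∈ frontier Q := by
    intro c hc hcM
    obtain ⟨u, hu, huQ⟩ := IsPreconnected.inter_frontier_nonempty
      (isPreconnected_insert_of_mem_componentsOff (connectedComponentIn_mem_componentsOff hc)) hQo
      ⟨p, Or.inl rfl, hpQ⟩ fun h => hQM c (h (Or.inr (mem_connectedComponentIn hc))) hcM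
    rcases hu with rfl | hu
    · rw [hQo.frontier_eq] at huQ
      exact absurd hpQ huQ.2
    · exact ⟨u, hu, huQ⟩
  obtain ⟨v, hvb, hvQ⟩ := key b hb (hMab (by simp))
  obtain ⟨u, hua, huQ⟩ := key a ha (hMab (by simp))
  have hfr : ∀ c ∈ frontier Q, (c : X) ∈ M := fun c hc => by
    simpa using frontier_connectedComponentIn_subset hMo p hc
  by_cases huv : u = v
  · rw [_root_.connectedComponentIn_eq hua, _root_.connectedComponentIn_eq hvb, huv]
  -- The points `u` and `v` are joined both by `M` and by `Q` with `u`, `v` added. A separating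
  -- point would lie in both, hence in `M` and in `Q`, which are disjoint. So `u = v` is a common
  -- point of the two components.
  obtain ⟨z, hzu, hzv, hz⟩ := hX u v (fun h => huv (Subtype.ext h))
  have hc : IsPreconnected (insert u (insert v Q)) :=
    isPreconnected_connectedComponentIn.subset_closure
      ((subset_insert _ _).trans (subset_insert _ _))
      (insert_subset (frontier_subset_closure huQ)
        (insert_subset (frontier_subset_closure hvQ) subset_closure))
  obtain ⟨w, hw, hwz⟩ := hz _ (hc.image _ continuous_subtype_val.continuousOn)
    (mem_image_of_mem _ (Or.inl rfl)) (mem_image_of_mem _ (Or.inr (Or.inl rfl)))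
  subst hwz
  rcases hw with rfl | rfl | hw
  · exact absurd rfl hzu
  · exact absurd rfl hzv
  · exact absurd (hz M hMc (hfr u huQ) (hfr v hvQ)) (hQM w hw)

theorem CutPointSeparated.mk_componentsOff_le [T2Space X] [CompactSpace X]
    [LocallyConnectedSpace X] (hX : CutPointSeparated X) [PreconnectedSpace K]
    [LocallyConnectedSpace K] (p : K) :
    Cardinal.mk (componentsOff p) ≤ Cardinal.mk (componentsOff (p : X)) := by
  choose x hx using fun C : componentsOff p => nonempty_of_mem_componentsOff C.2
  have hxp : ∀ C, x C ≠ p := fun C h => by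
    have hxC := hx C
    rw [h] at hxC
    exact notMem_of_mem_componentsOff C.2 hxC
  have hxp' : ∀ C, (x C : X) ≠ p := fun C h => hxp C (Subtype.ext h)
  refine Cardinal.mk_le_of_injective
    (f := fun C => ⟨_, connectedComponentIn_mem_componentsOff (hxp' C)⟩) fun C C' h => ?_
  have h' : connectedComponentIn {(p : X)}ᶜ (x C : X) = connectedComponentIn {(p : X)}ᶜ (x C') :=
    congrArg Subtype.val h
  apply Subtype.ext
  rw [eq_of_mem_componentsOff C.2 (hx C), eq_of_mem_componentsOff C'.2 (hx C')]
  exact hX.connectedComponentIn_eq (hxp C) (hxp C') (h' ▸ mem_connectedComponentIn (hxp' C'))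

/-- A point of `K` is chosen in each component at `p` in `X`; points in different components of `X \
{p}` cannot share a component of `K \ {p}`. -/
theorem mk_componentsOff_le_of_inter_nonempty (p : K)
    (h : ∀ C ∈ componentsOff (p : X), (C ∩ K).Nonempty) :
    Cardinal.mk (componentsOff (p : X)) ≤ Cardinal.mk (componentsOff p) := by
  have key : ∀ C : componentsOff (p : X), ∃ x : K, (x : X) ∈ (C : Set X) := fun C => by
    obtain ⟨x, hx, hxK⟩ := h C C.2
    exact ⟨⟨x, hxK⟩, hx⟩
  choose x hx using key
  have hxp : ∀ C, x C ≠ p := fun C h => by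
    have hxC := hx C
    rw [h] at hxC
    exact notMem_of_mem_componentsOff C.2 hxC
  refine Cardinal.mk_le_of_injective
    (f := fun C => ⟨_, connectedComponentIn_mem_componentsOff (hxp C)⟩) fun C C' hCC' => ?_
  have h' : connectedComponentIn {p}ᶜ (x C) = connectedComponentIn {p}ᶜ (x C') :=
    congrArg Subtype.val hCC'
  apply Subtype.ext
  rw [eq_of_mem_componentsOff C.2 (hx C), eq_of_mem_componentsOff C'.2 (hx C')]
  exact _root_.connectedComponentIn_eq (image_val_subset_connectedComponentIn
    (h' ▸ mem_connectedComponentIn (hxp C')) (hxp C))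

end Subcontinua

/-! ### Generic subcontinua -/

section Hyperspace

variable {X : Type u} [MetricSpace X]

/-- A separation of a compact set by disjoint open sets persists for all nearby compact sets.
Closedness makes `Cont X` compact, so Baire category applies to it. -/
theorem isClosed_setOf_isConnected :
    IsClosed {K : NonemptyCompacts X | IsConnected (K : Set X)} := by
  rw [← isOpen_compl_iff, isOpen_iff_mem_nhds]
  intro K hK
  have hpre : ¬ IsPreconnected (K : Set X) := fun h => hK ⟨K.nonempty, h⟩
  rw [isPreconnected_closed_iff] at hpre
  push Not at hpre
  obtain ⟨A, B, hA, hB, hAB, hKA, hKB, hd⟩ := hpre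
  obtain ⟨U, V, hU, hV, hAU, hBV, hUV⟩ := SeparatedNhds.of_isCompact_isCompact
    (K.isCompact.inter_right hA) (K.isCompact.inter_right hB) (by
      refine Set.disjoint_left.2 fun x hx hx' => ?_
      have : x ∈ (K : Set X) ∩ (A ∩ B) := ⟨hx.1, hx.2, hx'.2⟩
      rw [hd] at this
      exact this)
  have hKU : (K : Set X) ⊆ U ∪ V := fun x hx =>
    (hAB hx).imp (fun h => hAU ⟨hx, h⟩) fun h => hBV ⟨hx, h⟩
  filter_upwards [(NonemptyCompacts.isOpen_subsets_of_isOpen (hU.union hV)).mem_nhds hKU,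
    (NonemptyCompacts.isOpen_inter_nonempty_of_isOpen hU).mem_nhds
      (show ((K : Set X) ∩ U).Nonempty from hKA.mono fun x hx => ⟨hx.1, hAU hx⟩),
    (NonemptyCompacts.isOpen_inter_nonempty_of_isOpen hV).mem_nhds
      (show ((K : Set X) ∩ V).Nonempty from hKB.mono fun x hx => ⟨hx.1, hBV hx⟩)] with L h1 h2 h3 hL
  obtain ⟨x, -, hxU, hxV⟩ := hL.isPreconnected U V hU hV h1 h2 h3
  exact Set.disjoint_left.1 hUV hxU hxV

instance instCompactSpaceCont [CompactSpace X] : CompactSpace (Cont X) :=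
  isCompact_iff_compactSpace.1 isClosed_setOf_isConnected.isCompact

theorem isOpen_setOf_subset {U : Set X} (hU : IsOpen U) :
    IsOpen {K : Cont X | (K.1 : Set X) ⊆ U} :=
  (NonemptyCompacts.isOpen_subsets_of_isOpen hU).preimage continuous_subtype_val

theorem isOpen_setOf_inter_nonempty {U : Set X} (hU : IsOpen U) :
    IsOpen {K : Cont X | ((K.1 : Set X) ∩ U).Nonempty} :=
  (NonemptyCompacts.isOpen_inter_nonempty_of_isOpen hU).preimage continuous_subtype_val

theorem mem_closure_cont_of_forall {S : Set (Cont X)} {K : Cont X}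
    (h : ∀ ε > 0, ∃ L ∈ S, (∀ x ∈ (K.1 : Set X), ∃ y ∈ (L.1 : Set X), dist x y ≤ ε) ∧
      ∀ y ∈ (L.1 : Set X), ∃ x ∈ (K.1 : Set X), dist y x ≤ ε) : K ∈ closure S := by
  refine Metric.mem_closure_iff.2 fun ε hε => ?_
  obtain ⟨L, hL, h1, h2⟩ := h (ε / 2) (half_pos hε)
  refine ⟨L, hL, ?_⟩
  rw [Subtype.dist_eq, Metric.NonemptyCompacts.dist_eq]
  exact (Metric.hausdorffDist_le_of_mem_dist (half_pos hε).le h1 h2).trans_lt (half_lt_self hε)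

/-- The subcontinua covered by a forest of small open sets are dense. -/
theorem dense_setOf_isForest [CompactSpace X] [LocallyConnectedSpace X] {δ : ℝ} (hδ : 0 < δ) :
    Dense {K : Cont X | ∃ N U, IsForest δ N U ∧ (K.1 : Set X) ⊆ ⋃ i < N, U i} := by
  intro K
  refine mem_closure_cont_of_forall fun ε hε => ?_
  -- Staying inside `G` controls one half of the Hausdorff distance to `K`; containing the net `t`
  -- controls the other.
  obtain ⟨G, hGo, hG, hKG, hGK⟩ := exists_isOpen_isPreconnected_between K.2.isPreconnected hε
  obtain ⟨t, htK, ht⟩ := K.1.isCompact.elim_nhds_subcover (fun x => Metric.ball x ε)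
    fun x _ => Metric.ball_mem_nhds x hε
  obtain ⟨N, U, hU, hUc, hUG, hFU⟩ := exists_isForest_of_finite hδ hGo hG t.finite_toSet
    (fun x hx => hKG (htK x hx))
  obtain ⟨M, hMU, hM, hMc, htM⟩ := exists_isCompact_isPreconnected_superset
    (isOpen_biUnion fun i hi => hU.isOpen i hi) hUc t.finite_toSet.isCompact hFU
  have hne : M.Nonempty := by
    obtain ⟨x, hx⟩ := K.1.nonempty
    obtain ⟨y, hy, -⟩ := mem_iUnion₂.1 (ht hx)
    exact ⟨y, htM hy⟩
  refine ⟨⟨⟨⟨M, hM⟩, hne⟩, hne, hMc⟩, ⟨N, U, hU, hMU⟩, fun x hx => ?_, fun y hy => ?_⟩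
  · obtain ⟨y, hy, hxy⟩ := mem_iUnion₂.1 (ht hx)
    exact ⟨y, htM hy, (Metric.mem_ball.1 hxy).le⟩
  · obtain ⟨x, hx, hxy⟩ := hGK y (hUG (hMU hy))
    exact ⟨x, hx, hxy.le⟩

theorem setOf_isForest_mem_residual [CompactSpace X] [LocallyConnectedSpace X] {δ : ℝ}
    (hδ : 0 < δ) :
    {K : Cont X | ∃ N U, IsForest δ N U ∧ (K.1 : Set X) ⊆ ⋃ i < N, U i} ∈ residual (Cont X) := by
  refine residual_of_dense_open ?_ (dense_setOf_isForest hδ)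
  rw [isOpen_iff_mem_nhds]
  rintro K ⟨N, U, hU, hKU⟩
  filter_upwards [(isOpen_setOf_subset
    (isOpen_biUnion fun i (hi : i < N) => hU.isOpen i hi)).mem_nhds hKU] with L hL
  exact ⟨N, U, hU, hL⟩

theorem IsForest.preimage_val {δ : ℝ} {N : ℕ} {U : ℕ → Set X} (h : IsForest δ N U) (K : Set X) :
    IsForest δ N fun i => ((↑) : K → X) ⁻¹' U i where
  isOpen i hi := (h.isOpen i hi).preimage continuous_subtype_val
  dist_lt i hi x hx y hy := h.dist_lt i hi x hx y hy
  exists_parent k hk := by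
    obtain ⟨j, hj⟩ := h.exists_parent k hk
    exact ⟨j, fun i hi hij => (hj i hi hij).preimage _⟩

/-- Some copy `K` of `X` is covered by forests of every mesh 1/(n + 1). Separation is proved in `K`,
where the metric controls the mesh, and then transferred to `X` as a topological property. -/
theorem IsGHEC.cutPointSeparated [CompactSpace X] [ConnectedSpace X] [LocallyConnectedSpace X]
    (hG : IsGHEC X) : CutPointSeparated X := by
  obtain ⟨x₀⟩ := (inferInstance : Nonempty X)
  have : Nonempty (Cont X) := ⟨⟨{x₀}, by simpa using isConnected_singleton⟩⟩
  have hres := Filter.inter_mem hG (countable_iInter_mem.2 fun n : ℕ =>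
    setOf_isForest_mem_residual (X := X) (δ := 1 / ((n : ℝ) + 1)) Nat.one_div_pos_of_nat)
  obtain ⟨K, ⟨e⟩, hK⟩ := (dense_of_mem_residual hres).nonempty
  rw [mem_iInter] at hK
  have : CompactSpace (K.1 : Set X) := isCompact_iff_compactSpace.1 K.1.isCompact
  have : PreconnectedSpace (K.1 : Set X) := isPreconnected_iff_preconnectedSpace.1 K.2.isPreconnected
  have : LocallyConnectedSpace (K.1 : Set X) := e.isOpenEmbedding.locallyConnectedSpace
  refine CutPointSeparated.of_homeomorph (cutPointSeparated_of_isForest fun δ hδ => ?_) e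
  obtain ⟨n, hn⟩ := exists_nat_one_div_lt hδ
  obtain ⟨N, U, hU, hKU⟩ := hK n
  have hU' := hU.preimage_val (K.1 : Set X)
  refine ⟨N, _, ⟨hU'.isOpen, fun i hi x hx y hy => (hU'.dist_lt i hi x hx y hy).trans hn,
    hU'.exists_parent⟩, eq_univ_of_forall fun x => ?_⟩
  obtain ⟨i, hi, hx⟩ := mem_iUnion₂.1 (hKU x.2)
  exact mem_iUnion₂.2 ⟨i, hi, hx⟩

/-- The boundary of an open set is nowhere dense, so generically being a limit of points of `O`
already means being in `O`. -/
theorem mem_residual_of_isOpen {Y : Type*} [TopologicalSpace Y] {O : Set Y} (hO : IsOpen O) :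
    {y | y ∈ closure O → y ∈ O} ∈ residual Y := by
  have h : O ∪ (closure O)ᶜ ⊆ {y | y ∈ closure O → y ∈ O} := by
    rintro y (hy | hy) h
    exacts [hy, absurd h hy]
  refine Filter.mem_of_superset (residual_of_dense_open
    (hO.union isClosed_closure.isOpen_compl) fun y => ?_) h
  by_cases hy : y ∈ closure O
  · exact closure_mono subset_union_left hy
  · exact subset_closure (Or.inr hy)

/-- A subcontinuum meeting two components of the complement of `p` is a limit of subcontinua
meeting any given component. -/
theorem mem_closure_setOf_inter_nonempty [CompactSpace X] [PreconnectedSpace X]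
    [LocallyConnectedSpace X] {p : X} {C : Set X} (hC : C ∈ componentsOff p) {K : Cont X}
    (hp : p ∈ (K.1 : Set X)) :
    K ∈ closure {K : Cont X | ((K.1 : Set X) ∩ C).Nonempty} := by
  refine mem_closure_cont_of_forall fun ε hε => ?_
  obtain ⟨M, hMp, hM, hMc, hMn⟩ :=
    exists_isCompact_isPreconnected_subset (Metric.ball_mem_nhds p hε)
  have hpM := mem_of_mem_nhds hMn
  obtain ⟨x, hxM, hxC⟩ := mem_closure_iff_nhds.1 (mem_closure_of_mem_componentsOff hC) M hMn
  -- Since `p` is in the closure of `C`, adding to `K` a small continuum that is a neighbourhood of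
  -- `p` makes it meet `C`.
  refine ⟨⟨⟨⟨K.1 ∪ M, K.1.isCompact.union hM⟩, ⟨p, Or.inl hp⟩⟩, ⟨p, Or.inl hp⟩,
    K.2.isPreconnected.union p hp hpM hMc⟩, ⟨x, Or.inr hxM, hxC⟩, fun x hx => ⟨x, Or.inl hx,
    by simpa using hε.le⟩, ?_⟩
  rintro y (hy | hy)
  · exact ⟨y, hy, by simpa using hε.le⟩
  · exact ⟨p, hp, (Metric.mem_ball.1 (hMp hy)).le⟩

/-- Generically, a subcontinuum through a point `p` with at least three complementary components
meets all of them. -/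
theorem setOf_forall_inter_nonempty_mem_residual [CompactSpace X] [PreconnectedSpace X]
    [LocallyConnectedSpace X] :
    {K : Cont X | ∀ p ∈ (K.1 : Set X), 3 ≤ Cardinal.mk (componentsOff p) →
      ∀ C ∈ componentsOff p, (C ∩ K.1).Nonempty} ∈ residual (Cont X) := by
  have h : ⋂ p ∈ {p : X | 3 ≤ Cardinal.mk (componentsOff p)}, ⋂ C ∈ componentsOff p,
      {K : Cont X | K ∈ closure {K : Cont X | ((K.1 : Set X) ∩ C).Nonempty} →
        K ∈ {K : Cont X | ((K.1 : Set X) ∩ C).Nonempty}} ∈ residual (Cont X) :=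
    (countable_bInter_mem countable_setOf_three_le_componentsOff).2 fun p _ =>
      (countable_bInter_mem (countable_componentsOff p)).2 fun C hC =>
        mem_residual_of_isOpen (isOpen_setOf_inter_nonempty (isOpen_of_mem_componentsOff hC))
  filter_upwards [h] with K hK p hp hp3 C hC
  rw [inter_comm]
  exact mem_iInter₂.1 (mem_iInter₂.1 hK p hp3) C hC (mem_closure_setOf_inter_nonempty hC hp)

theorem IsGHEC.dense_branchingPointsOfOrder [CompactSpace X] [ConnectedSpace X]
    [LocallyConnectedSpace X] (hG : IsGHEC X) {m : Cardinal.{u}}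
    (hm : (branchingPointsOfOrder X m).Nonempty) : Dense (branchingPointsOfOrder X m) := by
  have hX := hG.cutPointSeparated
  obtain ⟨x₀, hx₀2, hx₀m⟩ := hm
  rw [dense_iff_inter_open]
  rintro U hU ⟨y, hy⟩
  obtain ⟨K, hKU, ⟨e⟩, hK⟩ := (dense_of_mem_residual
    (Filter.inter_mem hG setOf_forall_inter_nonempty_mem_residual)).inter_open_nonempty
    {K : Cont X | (K.1 : Set X) ⊆ U} (isOpen_setOf_subset hU)
    ⟨⟨{y}, by simpa using isConnected_singleton⟩, by simpa using hy⟩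
  have : CompactSpace (K.1 : Set X) := isCompact_iff_compactSpace.1 K.1.isCompact
  have : PreconnectedSpace (K.1 : Set X) := isPreconnected_iff_preconnectedSpace.1 K.2.isPreconnected
  have : LocallyConnectedSpace (K.1 : Set X) := e.isOpenEmbedding.locallyConnectedSpace
  have hord : Cardinal.mk (componentsOff (e.symm x₀)) = order x₀ := by
    rw [← (hX.of_homeomorph e.symm).order_eq, order_homeomorph]
  have hle := hX.mk_componentsOff_le (e.symm x₀)
  -- Components at a point of `K` inject into components in `X`, so a branching point of `K` has at
  -- least three in `X`. Only then does genericity apply and give the reverse inequality.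
  have h3 : 3 ≤ Cardinal.mk (componentsOff (e.symm x₀ : X)) := by
    refine le_trans ?_ hle
    rw [hord]
    have : (2 : Cardinal.{u}) + 1 ≤ order x₀ := by
      rw [show (2 : Cardinal.{u}) = ((2 : ℕ) : Cardinal.{u}) by norm_num, ← Cardinal.succ_natCast]
      exact Order.succ_le_of_lt (by simpa using hx₀2)
    exact le_trans (by norm_num) this
  have heq : order (e.symm x₀ : X) = order x₀ := by
    rw [hX.order_eq, ← hord]
    exact (mk_componentsOff_le_of_inter_nonempty _ (hK _ (e.symm x₀).2 h3)).antisymm hle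
  exact ⟨e.symm x₀, hKU (e.symm x₀).2, heq ▸ hx₀2, heq.trans hx₀m⟩

end Hyperspace

end PeanoGHEC

theorem mainTheorem5 {X : Type*} [TopologicalSpace X] [Nontrivial X]
    (hX : PeanoGHEC.IsPeanoContinuum X) (hG : PeanoGHEC.IsGHEC X) :
    PeanoGHEC.IsArc X ∨
      (PeanoGHEC.IsDendrite X ∧
        ∀ m : Cardinal, m ≤ Cardinal.aleph0 →
          Dense (PeanoGHEC.branchingPointsOfOrder X m) ∨
            PeanoGHEC.branchingPointsOfOrder X m = ∅) := by
  have := hX.compact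
  have := hX.connected
  have := hX.locallyConnected
  have := hX.metrizable
  let _ := TopologicalSpace.metrizableSpaceMetric X
  -- The second alternative covers every case: an arc is itself a dendrite, with no branching
  -- points.
  refine Or.inr ⟨⟨hX, hG.cutPointSeparated.no_simple_closed_curve⟩, fun m _ => ?_⟩
  rcases (PeanoGHEC.branchingPointsOfOrder X m).eq_empty_or_nonempty with h | h
  · exact Or.inr h
  · exact Or.inl (hG.dense_branchingPointsOfOrder h)
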